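/- Let $N\ge 2$ and $\beta\ge 0$. For $\mathbf a=(a_1,\dots,a_N)$ with all $a_j>0$ let $\Omega(\mathbf a)=(-a_1,a_1)\times\cdots\times(-a_N,a_N)\subset\mathbb R^N$ (a box; a cube if all $a_j$ are equal), and let $|\partial\Omega(\mathbf a)|$ be its perimeter, that is, the $(N-1)$-dimensional surface measure of its boundary. A real number $\lambda$ is a Robin eigenvalue of $\Omega=\Omega(\mathbf a)$ if there is a real function $u\in C^2(\Omega)\cap C^1(\overline\Omega)$, not identically zero, with $$\Delta u+\lambda u=0\ \text{ in }\Omega,\qquad \beta\,\frac{\partial u}{\partial n}+u=0\ \text{ on }\partial\Omega,$$ where $n$ is the outward unit normal on the faces of the box. The fundamental Robin eigenvalue $\lambda_1(\Omega)$ is the least Robin eigenvalue of $\Omega$. Then, among all boxes with a given perimeter, the cube, and only the cube, has the smallest fundamental Robin eigenvalue. That is, for every $P>0$ there is $h>0$ such that the cube $\Omega(h,\dots,h)$ has perimeter $P$ and a fundamental Robin eigenvalue, and every box $\Omega(\mathbf a)$ with $|\partial\Omega(\mathbf a)|=P$ has a fundamental Robin eigenvalue, which satisfies $$\lambda_1(\Omega(\mathbf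 a))\ \ge\ \lambda_1(\Omega(h,\dots,h)),$$ with equality only if $a_1=\dots=a_N=h$. -/

import Mathlib

open scoped ENNReal MeasureTheory Laplacian InnerProductSpace

namespace RobinBox

/-- The (open) box `(-a₁, a₁) × ⋯ × (-a_N, a_N)` in Euclidean space `ℝ^N`. -/
def box {N : ℕ} (a : Fin N → ℝ) : Set (EuclideanSpace ℝ (Fin N)) :=
  {x | ∀ j, x j ∈ Set.Ioo (-a j) (a j)}

/-- The perimeter (surface measure) `|∂Ω|` of a set `Ω ⊆ ℝ^N`: the `(N-1)`-dimensional Hausdorff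
measure of its topological boundary, normalised to agree with `(N-1)`-dimensional
Lebesgue measure. -/
noncomputable def perimeter {N : ℕ} (Ω : Set (EuclideanSpace ℝ (Fin N))) : ℝ≥0∞ :=
  μHE[N - 1] (frontier Ω)

/-- The partial derivative `∂u/∂x_j` at the point `x` of the closed box; at boundary points it is
the derivative taken within the closed box, that is the continuous extension of the interior
derivative when `u` is `C¹` up to the boundary. -/
noncomputable def partialDeriv {N : ℕ} (a : Fin N → ℝ) (u : EuclideanSpace ℝ (Fin N) → ℝ)
    (j : Fin N) (x : EuclideanSpace ℝ (Fin N)) : ℝ :=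
  fderivWithin ℝ u (closure (box a)) x (EuclideanSpace.single j 1)

/-- The Robin boundary condition `β ∂u/∂n + u = 0` on the boundary of the box. On the face
`x_j = a_j` the outward unit normal is `e_j`, on the face `x_j = -a_j` it is `-e_j`. For a function
that is `C¹` up to the boundary it makes no difference whether the (lower-dimensional)
edges of a face are included. -/
def RobinCondition {N : ℕ} (β : ℝ) (a : Fin N → ℝ) (u : EuclideanSpace ℝ (Fin N) → ℝ) : Prop :=
  ∀ x ∈ closure (box a), ∀ j,
    (x j = a j → β * partialDeriv a u j x + u x = 0) ∧
    (x j = -a j → β * (-partialDeriv a u j x) + u x = 0)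

/-- `u` is a (classical) eigenfunction with eigenvalue `lam` of the Robin problem on the box:
`u ∈ C²(Ω) ∩ C¹(closure Ω)`, `u` is not identically zero, `Δu + lam u = 0` in `Ω`, and
`β ∂u/∂n + u = 0` on `∂Ω`. -/
structure IsRobinEigenfunction {N : ℕ} (β : ℝ) (a : Fin N → ℝ) (lam : ℝ)
    (u : EuclideanSpace ℝ (Fin N) → ℝ) : Prop where
  contDiffOn_interior : ContDiffOn ℝ 2 u (box a)
  contDiffOn_closure : ContDiffOn ℝ 1 u (closure (box a))
  nontrivial : ∃ x ∈ box a, u x ≠ 0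
  equation : ∀ x ∈ box a, (Δ u) x + lam * u x = 0
  boundary : RobinCondition β a u

/-- `lam` is the fundamental Robin eigenvalue `λ₁` of the box: the least of all
eigenvalues of the Robin problem. -/
def IsFundamentalEigenvalue {N : ℕ} (β : ℝ) (a : Fin N → ℝ) (lam : ℝ) : Prop :=
  IsLeast {l : ℝ | ∃ u, IsRobinEigenfunction β a l u} lam

end RobinBox

/-! Separating variables, the product of the cosines `cos (k j * x j)` is an eigenfunction with
eigenvalue `∑ j, k j ^ 2` when each `k j` solves `arctan (β * κ) + a j * κ = π / 2`. That no
eigenvalue is smaller follows from a maximum principle (`le_eigenvalue_of_positive_supersolution`):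
an eigenfunction is divided by a positive cosine product of slightly lower frequencies, which then
tend to the true ones.

So `λ₁` is a sum of functions of one half-length each, and `κ ^ 2` is a decreasing convex function
of `log a`. Its tangent line at the cube (`exists_tangent_line`) gives `λ₁(box) - λ₁(cube) ≥ -C * ∑
j, log (a j / h)` with `C > 0`. At equal perimeter the last sum is at most zero, and vanishes only
for the cube (`sum_log_nonpos`). -/

namespace RobinBox

/-! ### The one-dimensional problem -/

/-- The one-dimensional frequency equation `arctan (β κ) + a κ = π / 2`, equivalent to
`β κ tan (a κ) = 1` for `0 < a κ < π / 2`, has a positive solution. -/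
lemma exists_frequency {β a : ℝ} (hβ : 0 ≤ β) (ha : 0 < a) :
    ∃ κ, 0 < κ ∧ Real.arctan (β * κ) + a * κ = Real.pi / 2 := by
  have hπ := Real.pi_pos
  have hc : ContinuousOn (fun κ => Real.arctan (β * κ) + a * κ)
      (Set.Icc 0 (Real.pi / (2 * a))) := by fun_prop
  have hmem : Real.pi / 2 ∈ Set.Icc (Real.arctan (β * 0) + a * 0)
      (Real.arctan (β * (Real.pi / (2 * a))) + a * (Real.pi / (2 * a))) := by
    -- At this right endpoint the linear term alone already reaches `π / 2`.
    have h1 : a * (Real.pi / (2 * a)) = Real.pi / 2 := by field_simp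
    have h2 : 0 ≤ Real.arctan (β * (Real.pi / (2 * a))) :=
      Real.arctan_nonneg.2 (by positivity)
    constructor
    · simpa using by positivity
    · linarith
  obtain ⟨κ, hκ, h⟩ := intermediate_value_Icc (by positivity) hc hmem
  refine ⟨κ, lt_of_le_of_ne hκ.1 ?_, h⟩
  rintro rfl
  simp at h
  linarith

lemma sin_arctan_eq_mul_cos (x : ℝ) : Real.sin (Real.arctan x) = x * Real.cos (Real.arctan x) := by
  rw [Real.sin_arctan, Real.cos_arctan]; ring

lemma cos_eq_of_frequency {β a κ : ℝ} (h : Real.arctan (β * κ) + a * κ = Real.pi / 2) :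
    Real.cos (κ * a) = β * κ * Real.sin (κ * a) := by
  have : κ * a = Real.pi / 2 - Real.arctan (β * κ) := by linarith
  rw [this, Real.cos_pi_div_two_sub, Real.sin_pi_div_two_sub, sin_arctan_eq_mul_cos]

/-- The two sides agree at the angle `π / 2 - arctan (β * κ)`. Below it the cosine is larger and the
sine smaller. -/
lemma mul_lt_cos_of_lt_frequency {β a κ : ℝ} (hβ : 0 ≤ β) (ha : 0 < a) (hκ : 0 < κ)
    (h : Real.arctan (β * κ) + a * κ < Real.pi / 2) :
    β * κ * Real.sin (κ * a) < Real.cos (κ * a) := by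
  have h0 : 0 ≤ Real.arctan (β * κ) := Real.arctan_nonneg.2 (by positivity)
  have h1 : 0 < κ * a := by positivity
  have h2 : Real.cos (Real.pi / 2 - Real.arctan (β * κ)) < Real.cos (κ * a) :=
    Real.cos_lt_cos_of_nonneg_of_le_pi h1.le (by linarith [Real.pi_pos]) (by linarith)
  have h3 : Real.sin (κ * a) ≤ Real.sin (Real.pi / 2 - Real.arctan (β * κ)) :=
    Real.sin_le_sin_of_le_of_le_pi_div_two (by linarith) (by linarith) (by linarith)
  rw [Real.cos_pi_div_two_sub, sin_arctan_eq_mul_cos] at h2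
  rw [Real.sin_pi_div_two_sub] at h3
  exact (mul_le_mul_of_nonneg_left h3 (by positivity)).trans_lt h2

lemma frequency_lt {β a κ κ' : ℝ} (hβ : 0 ≤ β) (ha : 0 < a) (hκ : κ' < κ)
    (h : Real.arctan (β * κ) + a * κ = Real.pi / 2) :
    Real.arctan (β * κ') + a * κ' < Real.pi / 2 := by
  have h1 : Real.arctan (β * κ') ≤ Real.arctan (β * κ) := Real.arctan_mono (by gcongr)
  have h2 : a * κ' < a * κ := by gcongr
  linarith

/-! ### Convexity of the one-dimensional eigenvalue in the logarithm of the length -/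

/-- The inverse cotangent. -/
noncomputable def arccot (y : ℝ) : ℝ := Real.pi / 2 - Real.arctan y

lemma arccot_pos (y : ℝ) : 0 < arccot y := sub_pos.2 (Real.arctan_lt_pi_div_two y)

lemma hasDerivAt_arccot (y : ℝ) : HasDerivAt arccot (-(1 / (1 + y ^ 2))) y :=
  (Real.hasDerivAt_arctan y).const_sub _

/-- With `θ = arctan y` the left side is `sin θ * cos θ ≤ cos θ = sin (π / 2 - θ) ≤ π / 2 - θ`. -/
lemma div_le_arccot (y : ℝ) : y / (1 + y ^ 2) ≤ arccot y := by
  have h1 : y / (1 + y ^ 2) = Real.sin (Real.arctan y) * Real.cos (Real.arctan y) := by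
    rw [sin_arctan_eq_mul_cos, mul_assoc, ← sq, Real.cos_sq_arctan]; ring
  have h2 : Real.sin (Real.arctan y) ≤ 1 := Real.sin_le_one _
  have h3 : Real.cos (Real.arctan y) ≤ arccot y := by
    rw [← Real.sin_pi_div_two_sub]
    exact Real.sin_le (arccot_pos y).le
  rw [h1]
  nlinarith [Real.cos_arctan_pos y]

lemma monotoneOn_mul_arccot :
    MonotoneOn (fun y => y * (1 + y ^ 2) * arccot y) (Set.Ici 0) := by
  have hd : ∀ y : ℝ, HasDerivAt (fun y => y * (1 + y ^ 2) * arccot y)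
      ((1 + 3 * y ^ 2) * arccot y - y) y := by
    intro y
    have h := ((hasDerivAt_id y).mul (((hasDerivAt_id y).pow 2).const_add 1)).mul
      (hasDerivAt_arccot y)
    refine HasDerivAt.congr_deriv (f' := _) h ?_
    simp only [id, Pi.mul_apply, Pi.pow_apply]
    field_simp
    ring
  refine monotoneOn_of_deriv_nonneg (convex_Ici 0)
    (fun y _ => (hd y).continuousAt.continuousWithinAt)
    (fun y _ => (hd y).differentiableAt.differentiableWithinAt) fun y hmem => ?_
  have hy : 0 < y := by simpa using hmem
  rw [(hd y).deriv]
  have h1 := div_le_arccot y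
  rw [div_le_iff₀ (by positivity)] at h1
  nlinarith [arccot_pos y, sq_nonneg y, mul_nonneg (sq_nonneg y) (arccot_pos y).le]

/-- Minus the logarithmic derivative of the half-length `arccot (β κ) / κ`, divided by `κ`. -/
noncomputable def logSlope (β κ : ℝ) : ℝ :=
  1 / κ ^ 2 + β / (κ * (1 + (β * κ) ^ 2) * arccot (β * κ))

lemma logSlope_pos {β κ : ℝ} (hβ : 0 ≤ β) (hκ : 0 < κ) : 0 < logSlope β κ := by
  have := arccot_pos (β * κ)
  unfold logSlope
  positivity

/-- This is the convexity: the derivative of `κ ^ 2` with respect to `log a` is `-2 / logSlope β κ`,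
and `κ` decreases as `a` grows. -/
lemma logSlope_anti {β κ κ' : ℝ} (hβ : 0 ≤ β) (hκ : 0 < κ) (h : κ ≤ κ') :
    logSlope β κ' ≤ logSlope β κ := by
  have hκ' := hκ.trans_le h
  unfold logSlope
  refine add_le_add (by gcongr) ?_
  rcases hβ.eq_or_lt with rfl | hβ
  · simp
  have hm := monotoneOn_mul_arccot (a := β * κ) (b := β * κ')
    (Set.mem_Ici.2 (by positivity)) (Set.mem_Ici.2 (by positivity)) (by gcongr)
  have h1 := arccot_pos (β * κ)
  have h2 := arccot_pos (β * κ')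
  have : κ * (1 + (β * κ) ^ 2) * arccot (β * κ) ≤
      κ' * (1 + (β * κ') ^ 2) * arccot (β * κ') := by
    simp only [mul_assoc] at hm ⊢
    exact le_of_mul_le_mul_left hm hβ
  gcongr

/-- The tangent line inequality for the eigenvalue `κ ^ 2` as a convex function of `log a`. -/
lemma exists_tangent_line {β k : ℝ} (hβ : 0 ≤ β) (hk : 0 < k) :
    ∃ C, 0 < C ∧ ∀ κ, 0 < κ →
      k ^ 2 + C * Real.log (arccot (β * k) / k) ≤
        κ ^ 2 + C * Real.log (arccot (β * κ) / κ) := by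
  have hC : 0 < 2 / logSlope β k := div_pos two_pos (logSlope_pos hβ hk)
  -- `C` is minus the slope of `κ ^ 2` against `log a` at `κ = k`. The difference of the two sides
  -- then has derivative `x * (2 - C * logSlope β x)`, which changes sign from minus to plus at `k`.
  refine ⟨2 / logSlope β k, hC, fun κ hκ => ?_⟩
  set C := 2 / logSlope β k with hCdef
  have hCk : C * logSlope β k = 2 := div_mul_cancel₀ _ (logSlope_pos hβ hk).ne'
  have hd : ∀ x, 0 < x → HasDerivAt
      (fun κ => κ ^ 2 + C * Real.log (arccot (β * κ) / κ)) (x * (2 - C * logSlope β x)) x := by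
    intro x hx
    have hA := arccot_pos (β * x)
    have h1 : HasDerivAt (fun κ => arccot (β * κ)) (-(1 / (1 + (β * x) ^ 2)) * (β * 1)) x :=
      (hasDerivAt_arccot (β * x)).comp x ((hasDerivAt_id x).const_mul β)
    have h2 := ((h1.div (hasDerivAt_id x) hx.ne').log (div_pos hA hx).ne').const_mul C
    have h3 := (hasDerivAt_pow 2 x).add h2
    refine HasDerivAt.congr_deriv (f' := _) h3 ?_
    simp only [logSlope, id, Pi.div_apply]
    field_simp
    ring
  have hdiff : ∀ s ⊆ Set.Ioi (0 : ℝ), DifferentiableOn ℝ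
      (fun κ => κ ^ 2 + C * Real.log (arccot (β * κ) / κ)) s :=
    fun s hs x hx => (hd x (hs hx)).differentiableAt.differentiableWithinAt
  refine isMinOn_Ioi_of_deriv (a := 0) (b := k) (hd k hk).continuousAt
    (hdiff _ Set.Ioo_subset_Ioi_self) (hdiff _ (Set.Ioi_subset_Ioi hk.le)) ?_ ?_ hκ
  · intro x hx
    rw [(hd x hx.1).deriv]
    have := mul_le_mul_of_nonneg_left (logSlope_anti hβ hx.1 hx.2.le) hC.le
    exact mul_nonpos_of_nonneg_of_nonpos hx.1.le (by linarith)
  · intro x hx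
    have hx0 : 0 < x := hk.trans hx
    rw [(hd x hx0).deriv]
    have := mul_le_mul_of_nonneg_left (logSlope_anti hβ hk hx.le) hC.le
    exact mul_nonneg hx0.le (by linarith)

/-! ### The geometric inequality -/

/-- Each index is left out by exactly one `j`, hence counted `n` times. -/
lemma sum_log_succAbove {n : ℕ} (f : Fin (n + 1) → ℝ) :
    ∑ j, ∑ i, f (Fin.succAbove j i) = n * ∑ j, f j := by
  have h : ∀ j, ∑ i, f (Fin.succAbove j i) = ∑ i, f i - f j := fun j => by
    rw [Fin.sum_univ_succAbove f j]; ring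
  simp only [h, Finset.sum_sub_distrib, Finset.sum_const, Finset.card_univ, Fintype.card_fin,
    nsmul_eq_mul]
  push_cast
  ring

/-- Among positive families with given `∑ⱼ ∏_{i ≠ j} bᵢ`, the constant one has the largest
product. -/
lemma sum_log_nonpos {n : ℕ} (hn : 1 ≤ n) {b : Fin (n + 1) → ℝ} (hb : ∀ j, 0 < b j)
    (h : ∑ j, ∏ i, b (Fin.succAbove j i) = n + 1) :
    ∑ j, Real.log (b j) ≤ 0 ∧ (∑ j, Real.log (b j) = 0 → ∀ j, b j = 1) := by
  have hn' : (0 : ℝ) < n := by exact_mod_cast hn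
  have hlog : ∀ j, Real.log (∏ i, b (Fin.succAbove j i)) =
      ∑ i, Real.log (b (Fin.succAbove j i)) := fun j =>
    Real.log_prod fun i _ => (hb _).ne'
  have hpos : ∀ j, 0 < ∏ i, b (Fin.succAbove j i) := fun j => Finset.prod_pos fun i _ => hb _
  -- The inequality `log t ≤ t - 1` is applied to the products, not to the `b j`: the right sides
  -- then add up to zero by `h`, and the left sides to `n * ∑ j, log (b j)`.
  have hle : ∀ j, Real.log (∏ i, b (Fin.succAbove j i)) ≤ ∏ i, b (Fin.succAbove j i) - 1 :=
    fun j => Real.log_le_sub_one_of_pos (hpos j)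
  have hsum : ∑ j, Real.log (∏ i, b (Fin.succAbove j i)) = n * ∑ j, Real.log (b j) := by
    simp only [hlog]
    exact sum_log_succAbove fun j => Real.log (b j)
  have hzero : ∑ j, (∏ i, b (Fin.succAbove j i) - 1) = 0 := by
    rw [Finset.sum_sub_distrib, h]
    simp
  refine ⟨?_, fun h0 j => ?_⟩
  · have := Finset.sum_le_sum fun j (_ : j ∈ Finset.univ) => hle j
    rw [hsum, hzero] at this
    nlinarith
  · have heq := (Finset.sum_eq_sum_iff_of_le fun j (_ : j ∈ Finset.univ) => hle j).1
      (by rw [hsum, hzero, h0, mul_zero]) j (Finset.mem_univ j)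
    have h1 : ∏ i, b (Fin.succAbove j i) = 1 := by
      by_contra hne
      exact (Real.log_lt_sub_one_of_pos (hpos j) hne).ne heq
    have h2 : Real.log (b j) = 0 := by
      have := Fin.sum_univ_succAbove (fun j => Real.log (b j)) j
      rw [h0, ← hlog, h1, Real.log_one] at this
      linarith
    exact Real.eq_one_of_pos_of_log_eq_zero (hb j) h2

/-! ### The box, its closure and its perimeter -/

lemma box_eq_preimage {N : ℕ} (a : Fin N → ℝ) :
    box a = EuclideanSpace.equiv (Fin N) ℝ ⁻¹' Set.univ.pi fun j => Set.Ioo (-a j) (a j) := by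
  ext x; simp [box]

lemma isOpen_box {N : ℕ} (a : Fin N → ℝ) : IsOpen (box a) := by
  rw [box_eq_preimage]
  exact (isOpen_set_pi Set.finite_univ fun _ _ => isOpen_Ioo).preimage
    (EuclideanSpace.equiv (Fin N) ℝ).continuous

lemma closure_box {N : ℕ} {a : Fin N → ℝ} (ha : ∀ j, 0 < a j) :
    closure (box a) = {x | ∀ j, x j ∈ Set.Icc (-a j) (a j)} := by
  have h := (EuclideanSpace.equiv (Fin N) ℝ).toHomeomorph.preimage_closure
    (Set.univ.pi fun j => Set.Ioo (-a j) (a j))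
  rw [box_eq_preimage]
  refine h.symm.trans ?_
  rw [closure_pi_set]
  ext x
  simp only [Set.mem_preimage, Set.mem_univ_pi, Set.mem_ofPred_eq]
  refine forall_congr' fun j => ?_
  rw [closure_Ioo (by linarith [ha j])]
  rfl

/-- The part of the closed box lying in the hyperplane `x j = c`. -/
def face {N : ℕ} (a : Fin N → ℝ) (j : Fin N) (c : ℝ) : Set (EuclideanSpace ℝ (Fin N)) :=
  {x | x j = c ∧ ∀ i, x i ∈ Set.Icc (-a i) (a i)}

lemma isClosed_face {N : ℕ} (a : Fin N → ℝ) (j : Fin N) (c : ℝ) : IsClosed (face a j c) := by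
  unfold face
  simp only [Set.ofPred_and, Set.ofPred_forall]
  refine (isClosed_eq (by fun_prop) continuous_const).inter (isClosed_iInter fun i => ?_)
  exact isClosed_Icc.preimage (by fun_prop : Continuous fun x : EuclideanSpace ℝ (Fin N) => x i)

/-- The embedding of `ℝⁿ` in `ℝⁿ⁺¹` as the hyperplane `x j = c`. -/
noncomputable def insertCoord {n : ℕ} (j : Fin (n + 1)) (c : ℝ) (y : EuclideanSpace ℝ (Fin n)) :
    EuclideanSpace ℝ (Fin (n + 1)) :=
  WithLp.toLp 2 (j.insertNth (α := fun _ => ℝ) c y)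

lemma isometry_insertCoord {n : ℕ} (j : Fin (n + 1)) (c : ℝ) : Isometry (insertCoord j c) := by
  refine Isometry.of_dist_eq fun x y => ?_
  simp [EuclideanSpace.dist_eq, insertCoord, Fin.sum_univ_succAbove _ j]

lemma face_eq_image {n : ℕ} {a : Fin (n + 1) → ℝ} (j : Fin (n + 1)) {c : ℝ}
    (hc : c ∈ Set.Icc (-a j) (a j)) :
    face a j c = insertCoord j c ''
      (WithLp.ofLp ⁻¹' Set.Icc (fun i => -a (j.succAbove i)) fun i => a (j.succAbove i)) := by
  ext x
  constructor
  · rintro ⟨h1, h2⟩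
    refine ⟨WithLp.toLp 2 fun i => x (j.succAbove i),
      ⟨fun i => (h2 _).1, fun i => (h2 _).2⟩, ?_⟩
    ext i
    rcases Fin.eq_self_or_eq_succAbove j i with rfl | ⟨i, rfl⟩
    · simp [insertCoord, h1]
    · simp [insertCoord]
  · rintro ⟨y, hy, rfl⟩
    refine ⟨by simp [insertCoord], fun i => ?_⟩
    rcases Fin.eq_self_or_eq_succAbove j i with rfl | ⟨i, rfl⟩
    · simpa [insertCoord] using hc
    · simpa [insertCoord] using ⟨hy.1 i, hy.2 i⟩

lemma measure_face {n : ℕ} {a : Fin (n + 1) → ℝ} (ha : ∀ j, 0 < a j) (j : Fin (n + 1)) {c : ℝ}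
    (hc : c ∈ Set.Icc (-a j) (a j)) :
    μHE[n] (face a j c) = ENNReal.ofReal (∏ i, 2 * a (j.succAbove i)) := by
  rw [face_eq_image j hc, (isometry_insertCoord j c).euclideanHausdorffMeasure_image,
    EuclideanSpace.euclideanHausdorffMeasure_eq_volume,
    (PiLp.volume_preserving_ofLp (Fin n)).measure_preimage measurableSet_Icc.nullMeasurableSet,
    Real.volume_Icc_pi, ← ENNReal.ofReal_prod_of_nonneg]
  · simp only [sub_neg_eq_add, ← two_mul]
  · intro i _
    linarith [ha (j.succAbove i)]

lemma measure_hyperplane (n : ℕ) (i : Fin n) (d : ℝ) :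
    MeasureTheory.volume {y : EuclideanSpace ℝ (Fin n) | y i = d} = 0 := by
  have h := (PiLp.volume_preserving_ofLp (Fin n)).measure_preimage
    (s := {y : Fin n → ℝ | y i = d})
    (measurableSet_eq_fun (by fun_prop) (by fun_prop)).nullMeasurableSet
  exact h.trans (MeasureTheory.Measure.pi_hyperplane (α := fun _ : Fin n => ℝ) (fun _ => MeasureTheory.volume) i d)

/-- Inside the first face, an isometric copy of a box in `ℝⁿ`, the second one cuts out part of a
coordinate hyperplane. -/
lemma measure_face_inter {n : ℕ} {a : Fin (n + 1) → ℝ} {j j' : Fin (n + 1)} {c c' : ℝ}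
    (hc : c ∈ Set.Icc (-a j) (a j)) (hj : j' ≠ j) :
    μHE[n] (face a j c ∩ face a j' c') = 0 := by
  obtain ⟨i, rfl⟩ := Fin.exists_succAbove_eq hj
  refine MeasureTheory.measure_mono_null (t := insertCoord j c '' {y | y i = c'}) ?_ ?_
  · rintro x ⟨h1, h2⟩
    rw [face_eq_image j hc] at h1
    obtain ⟨y, -, rfl⟩ := h1
    exact ⟨y, by simpa [insertCoord] using h2.1, rfl⟩
  · rw [(isometry_insertCoord j c).euclideanHausdorffMeasure_image,
      EuclideanSpace.euclideanHausdorffMeasure_eq_volume, measure_hyperplane]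

lemma frontier_box {N : ℕ} {a : Fin N → ℝ} (ha : ∀ j, 0 < a j) :
    frontier (box a) = ⋃ p : Fin N × Bool, face a p.1 (bif p.2 then a p.1 else -a p.1) := by
  rw [(isOpen_box a).frontier_eq, closure_box ha]
  ext x
  simp only [Set.mem_sdiff, Set.mem_iUnion, Prod.exists, Bool.exists_bool, face, Set.mem_ofPred_eq,
    cond_true, cond_false, box]
  constructor
  · rintro ⟨h1, h2⟩
    push Not at h2
    obtain ⟨j, hj⟩ := h2
    refine ⟨j, ?_⟩
    by_cases h : x j = -a j
    · exact Or.inl ⟨h, h1⟩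
    · refine Or.inr ⟨le_antisymm (h1 j).2 ?_, h1⟩
      by_contra hlt
      exact hj ⟨lt_of_le_of_ne (h1 j).1 (Ne.symm h), not_le.1 hlt⟩
  · rintro ⟨j, ⟨h1, h2⟩ | ⟨h1, h2⟩⟩
    · exact ⟨h2, fun h => (h j).1.ne' h1⟩
    · exact ⟨h2, fun h => (h j).2.ne h1⟩

lemma perimeter_box {n : ℕ} {a : Fin (n + 1) → ℝ} (ha : ∀ j, 0 < a j) :
    perimeter (box a) = ENNReal.ofReal (∑ j, 2 * ∏ i, 2 * a (Fin.succAbove j i)) := by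
  have hc : ∀ p : Fin (n + 1) × Bool,
      (bif p.2 then a p.1 else -a p.1) ∈ Set.Icc (-a p.1) (a p.1) := by
    rintro ⟨j, _ | _⟩ <;> simp [(ha j).le]
  have hpos : ∀ j : Fin (n + 1), 0 ≤ ∏ i, 2 * a (j.succAbove i) := fun j =>
    Finset.prod_nonneg fun i _ => by linarith [ha (j.succAbove i)]
  rw [perimeter, Nat.add_sub_cancel, frontier_box ha, MeasureTheory.measure_iUnion₀,
    tsum_fintype, Fintype.sum_prod_type, ENNReal.ofReal_sum_of_nonneg]
  · refine Finset.sum_congr rfl fun j _ => ?_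
    rw [Fintype.sum_bool, measure_face ha j (hc (j, true)), measure_face ha j (hc (j, false)),
      ← ENNReal.ofReal_add (hpos j) (hpos j), two_mul]
  · exact fun j _ => mul_nonneg zero_le_two (hpos j)
  · rintro ⟨j, s⟩ ⟨j', s'⟩ hne
    by_cases hj : j' = j
    · subst hj
      refine Disjoint.aedisjoint (Set.disjoint_left.2 fun x h1 h2 => ?_)
      have h := h1.1.symm.trans h2.1
      have := ha j'
      cases s <;> cases s' <;> simp at h hne <;> linarith
    · exact measure_face_inter (hc (j, s)) hj
  · exact fun p => (isClosed_face _ _ _).measurableSet.nullMeasurableSet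

/-! ### Second derivatives and the Laplacian along coordinate lines -/

/-- A positive second derivative would make `x` a local minimum as well, so `f` would be locally
constant. -/
lemma deriv_deriv_nonpos_of_isLocalMax {f : ℝ → ℝ} {x : ℝ} (h : IsLocalMax f x)
    (hf : ContinuousAt f x) : deriv (deriv f) x ≤ 0 := by
  by_contra! hpos
  have hmin := isLocalMin_of_deriv_deriv_pos hpos h.deriv_eq_zero hf
  have hconst : f =ᶠ[nhds x] fun _ => f x := by
    filter_upwards [h, hmin] with y h1 h2 using le_antisymm h1 h2
  have := hconst.deriv.deriv_eq
  simp [this] at hpos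

lemma iteratedFDeriv_two_eq_deriv {E : Type*} [NormedAddCommGroup E] [NormedSpace ℝ E]
    {f : E → ℝ} {x : E} (hf : ContDiffAt ℝ 2 f x) (e : E) :
    iteratedFDeriv ℝ 2 f x ![e, e] = deriv (deriv fun t : ℝ => f (x + t • e)) 0 := by
  have hline : ∀ t : ℝ, HasDerivAt (fun t : ℝ => x + t • e) e t := fun t => by
    simpa using ((hasDerivAt_id t).smul_const e).const_add x
  have hcont : Filter.Tendsto (fun t : ℝ => x + t • e) (nhds 0) (nhds x) := by
    simpa using (hline 0).continuousAt.tendsto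
  have h1 : (deriv fun t : ℝ => f (x + t • e)) =ᶠ[nhds 0] fun t => fderiv ℝ f (x + t • e) e := by
    filter_upwards [hcont.eventually (hf.eventually (by simp))] with t ht
    exact ((ht.differentiableAt (by simp)).hasFDerivAt.comp_hasDerivAt t (hline t)).deriv
  have hd : HasFDerivAt (fderiv ℝ f) (fderiv ℝ (fderiv ℝ f) x) (x + (0 : ℝ) • e) := by
    rw [zero_smul, add_zero]
    exact ((hf.fderiv_right (m := 1) (by norm_num)).differentiableAt (by simp)).hasFDerivAt
  have h2 : HasDerivAt (fun t : ℝ => fderiv ℝ f (x + t • e)) (fderiv ℝ (fderiv ℝ f) x e) 0 :=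
    hd.comp_hasDerivAt 0 (hline 0)
  have h3 : HasDerivAt (fun t : ℝ => fderiv ℝ f (x + t • e) e) (fderiv ℝ (fderiv ℝ f) x e e) 0 :=
    ((ContinuousLinearMap.apply ℝ ℝ e).hasFDerivAt).comp_hasDerivAt 0 h2
  rw [h1.deriv_eq, h3.deriv, iteratedFDeriv_two_apply]
  rfl

variable {N : ℕ}

lemma laplacian_eq_sum_deriv {f : EuclideanSpace ℝ (Fin N) → ℝ} {x : EuclideanSpace ℝ (Fin N)}
    (hf : ContDiffAt ℝ 2 f x) :
    (Δ f) x = ∑ j, deriv (deriv fun t : ℝ => f (x + t • EuclideanSpace.single j (1 : ℝ))) 0 := by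
  rw [InnerProductSpace.laplacian_eq_iteratedFDeriv_orthonormalBasis f (EuclideanSpace.basisFun (Fin N) ℝ)]
  refine Finset.sum_congr rfl fun j _ => ?_
  rw [EuclideanSpace.basisFun_apply]
  exact iteratedFDeriv_two_eq_deriv hf _

lemma laplacian_nonpos_of_isLocalMax {f : EuclideanSpace ℝ (Fin N) → ℝ}
    {x : EuclideanSpace ℝ (Fin N)} (hf : ContDiffAt ℝ 2 f x) (h : IsLocalMax f x) :
    (Δ f) x ≤ 0 := by
  rw [laplacian_eq_sum_deriv hf]
  refine Finset.sum_nonpos fun j _ => ?_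
  have hline : ContinuousAt (fun t : ℝ => x + t • EuclideanSpace.single j (1 : ℝ)) 0 := by fun_prop
  have hx : x + (0 : ℝ) • EuclideanSpace.single j (1 : ℝ) = x := by simp
  refine deriv_deriv_nonpos_of_isLocalMax ?_ ?_
  · have : Filter.Tendsto (fun t : ℝ => x + t • EuclideanSpace.single j (1 : ℝ)) (nhds 0)
        (nhds x) := by simpa only [ContinuousAt, hx] using hline
    filter_upwards [this.eventually h] with t ht
    simpa using ht
  · refine ContinuousAt.comp (g := f) ?_ hline
    rw [hx]
    exact hf.continuousAt

/-! ### Products of cosines -/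

/-- The function `x ↦ ∏ⱼ cos (kⱼ xⱼ)`. -/
noncomputable def cosProd (k : Fin N → ℝ) (x : EuclideanSpace ℝ (Fin N)) : ℝ :=
  ∏ j, Real.cos (k j * x j)

lemma contDiff_cosProd (k : Fin N → ℝ) {n : WithTop ℕ∞} : ContDiff ℝ n (cosProd k) := by
  unfold cosProd
  fun_prop

lemma cosProd_eq (k : Fin N → ℝ) (x : EuclideanSpace ℝ (Fin N)) (j : Fin N) :
    cosProd k x = Real.cos (k j * x j) * ∏ i ∈ Finset.univ.erase j, Real.cos (k i * x i) :=
  (Finset.mul_prod_erase _ _ (Finset.mem_univ j)).symm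

lemma cosProd_line (k : Fin N → ℝ) (x : EuclideanSpace ℝ (Fin N)) (j : Fin N) (t : ℝ) :
    cosProd k (x + t • EuclideanSpace.single j (1 : ℝ)) =
      Real.cos (k j * (x j + t)) * ∏ i ∈ Finset.univ.erase j, Real.cos (k i * x i) := by
  rw [cosProd_eq k _ j]
  congr 1
  · simp
  · refine Finset.prod_congr rfl fun i hi => ?_
    simp [(Finset.mem_erase.1 hi).1]

lemma hasDerivAt_cosProd_line (k : Fin N → ℝ) (x : EuclideanSpace ℝ (Fin N)) (j : Fin N) (t : ℝ) :
    HasDerivAt (fun t : ℝ => cosProd k (x + t • EuclideanSpace.single j (1 : ℝ)))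
      (-(k j * Real.sin (k j * (x j + t))) *
        ∏ i ∈ Finset.univ.erase j, Real.cos (k i * x i)) t := by
  simp only [cosProd_line]
  have h := (((hasDerivAt_id t).const_add (x j)).const_mul (k j)).cos.mul_const
    (∏ i ∈ Finset.univ.erase j, Real.cos (k i * x i))
  refine HasDerivAt.congr_deriv (f' := _) h ?_
  simp only [id]
  ring

lemma laplacian_cosProd (k : Fin N → ℝ) (x : EuclideanSpace ℝ (Fin N)) :
    (Δ (cosProd k)) x = -(∑ j, k j ^ 2) * cosProd k x := by
  rw [laplacian_eq_sum_deriv (contDiff_cosProd k).contDiffAt, neg_mul, Finset.sum_mul,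
    ← Finset.sum_neg_distrib]
  refine Finset.sum_congr rfl fun j _ => ?_
  have h1 := funext fun t => (hasDerivAt_cosProd_line k x j t).deriv
  have h2 := ((((hasDerivAt_id (0 : ℝ)).const_add (x j)).const_mul (k j)).sin.const_mul
    (k j)).neg.mul_const (∏ i ∈ Finset.univ.erase j, Real.cos (k i * x i))
  rw [h1, cosProd_eq k x j]
  refine h2.deriv.trans ?_
  simp only [id, add_zero]
  ring

lemma fderiv_cosProd (k : Fin N → ℝ) (x : EuclideanSpace ℝ (Fin N)) (j : Fin N) :
    fderiv ℝ (cosProd k) x (EuclideanSpace.single j 1) =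
      -(k j * Real.sin (k j * x j)) * ∏ i ∈ Finset.univ.erase j, Real.cos (k i * x i) := by
  have h : HasDerivAt (fun t : ℝ => cosProd k (x + t • EuclideanSpace.single j (1 : ℝ)))
      (fderiv ℝ (cosProd k) x (EuclideanSpace.single j 1)) 0 :=
    ((contDiff_cosProd k (n := 1)).differentiable (by simp) x).hasFDerivAt.hasLineDerivAt _
  simpa using h.unique (hasDerivAt_cosProd_line k x j 0)

/-! ### The closed box as a domain of differentiation -/

variable {a : Fin N → ℝ}

lemma convex_closure_box (a : Fin N → ℝ) : Convex ℝ (closure (box a)) := by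
  rw [box_eq_preimage]
  refine Convex.closure ?_
  exact (convex_pi fun _ _ => convex_Ioo _ _).linear_preimage
    (EuclideanSpace.equiv (Fin N) ℝ).toLinearMap

lemma isCompact_closure_box (ha : ∀ j, 0 < a j) : IsCompact (closure (box a)) := by
  have h : closure (box a) = EuclideanSpace.equiv (Fin N) ℝ ⁻¹'
      Set.univ.pi fun j => Set.Icc (-a j) (a j) := by
    rw [closure_box ha]
    ext x
    exact Set.mem_univ_pi.symm
  rw [h]
  exact (EuclideanSpace.equiv (Fin N) ℝ).toHomeomorph.isCompact_preimage.2
    (isCompact_univ_pi fun _ => isCompact_Icc)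

lemma zero_mem_box (ha : ∀ j, 0 < a j) : (0 : EuclideanSpace ℝ (Fin N)) ∈ box a := fun j => by
  simpa using ha j

lemma uniqueDiffOn_closure_box (ha : ∀ j, 0 < a j) : UniqueDiffOn ℝ (closure (box a)) :=
  uniqueDiffOn_convex (convex_closure_box a)
    ⟨0, mem_interior.2 ⟨box a, subset_closure, isOpen_box a, zero_mem_box ha⟩⟩

lemma partialDeriv_cosProd (ha : ∀ j, 0 < a j) (k : Fin N → ℝ) (j : Fin N)
    {x : EuclideanSpace ℝ (Fin N)} (hx : x ∈ closure (box a)) :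
    partialDeriv a (cosProd k) j x =
      -(k j * Real.sin (k j * x j)) * ∏ i ∈ Finset.univ.erase j, Real.cos (k i * x i) := by
  rw [partialDeriv, fderivWithin_eq_fderiv (uniqueDiffOn_closure_box ha x hx)
    ((contDiff_cosProd k (n := 1)).differentiable (by simp) x), fderiv_cosProd]

/-- The derivative of a function that is maximal at a point of the closed box, in the direction
of another point of the closed box, is nonpositive. -/
lemma fderivWithin_nonpos_of_isMaxOn {w : EuclideanSpace ℝ (Fin N) → ℝ}
    {x : EuclideanSpace ℝ (Fin N)} (hx : x ∈ closure (box a))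
    (hw : DifferentiableWithinAt ℝ w (closure (box a)) x) (hmax : IsMaxOn w (closure (box a)) x)
    {v : EuclideanSpace ℝ (Fin N)} (hv : x + v ∈ closure (box a)) :
    fderivWithin ℝ w (closure (box a)) x v ≤ 0 :=
  hmax.localize.hasFDerivWithinAt_nonpos hw.hasFDerivWithinAt
    (mem_posTangentConeAt_of_segment_subset ((convex_closure_box a).segment_subset hx hv))

lemma partialDeriv_nonneg_of_isMaxOn (ha : ∀ j, 0 < a j) {w : EuclideanSpace ℝ (Fin N) → ℝ}
    {x : EuclideanSpace ℝ (Fin N)} (hx : x ∈ closure (box a))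
    (hw : DifferentiableWithinAt ℝ w (closure (box a)) x) (hmax : IsMaxOn w (closure (box a)) x)
    {j : Fin N} (hj : x j = a j) : 0 ≤ partialDeriv a w j x := by
  -- The step `-a j` leads from the face to the midplane `x j = 0`, staying in the closed box.
  have hv : x + -(a j) • EuclideanSpace.single j (1 : ℝ) ∈ closure (box a) := by
    rw [closure_box ha] at hx ⊢
    intro i
    by_cases h : i = j
    · subst h
      simp [hj, (ha i).le]
    · simpa [h] using hx i
  have h := fderivWithin_nonpos_of_isMaxOn hx hw hmax hv
  rw [map_smul, smul_eq_mul] at h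
  have := ha j
  unfold partialDeriv
  nlinarith

lemma partialDeriv_nonpos_of_isMaxOn (ha : ∀ j, 0 < a j) {w : EuclideanSpace ℝ (Fin N) → ℝ}
    {x : EuclideanSpace ℝ (Fin N)} (hx : x ∈ closure (box a))
    (hw : DifferentiableWithinAt ℝ w (closure (box a)) x) (hmax : IsMaxOn w (closure (box a)) x)
    {j : Fin N} (hj : x j = -a j) : partialDeriv a w j x ≤ 0 := by
  have hv : x + (a j) • EuclideanSpace.single j (1 : ℝ) ∈ closure (box a) := by
    rw [closure_box ha] at hx ⊢
    intro i
    by_cases h : i = j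
    · subst h
      simp [hj, (ha i).le]
    · simpa [h] using hx i
  have h := fderivWithin_nonpos_of_isMaxOn hx hw hmax hv
  rw [map_smul, smul_eq_mul] at h
  have := ha j
  unfold partialDeriv
  nlinarith

/-! ### The fundamental eigenvalue of a box -/

/-- Comparison principle: if `φ` is positive on the closed box, satisfies `Δφ + Λφ = 0` and the
strict boundary inequality `β ∂φ/∂n + φ > 0`, then a Robin eigenfunction that is positive somewhere
has eigenvalue at least `Λ`. -/
lemma le_eigenvalue_of_positive_supersolution {β Λ lam : ℝ} (hβ : 0 ≤ β) (ha : ∀ j, 0 < a j)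
    {φ u : EuclideanSpace ℝ (Fin N) → ℝ} (hφ : ContDiff ℝ 2 φ)
    (hpos : ∀ x ∈ closure (box a), 0 < φ x) (heq : ∀ x, (Δ φ) x = -Λ * φ x)
    (hbd : ∀ x ∈ closure (box a), ∀ j,
      (x j = a j → 0 < β * partialDeriv a φ j x + φ x) ∧
      (x j = -a j → 0 < β * (-partialDeriv a φ j x) + φ x))
    (hu : IsRobinEigenfunction β a lam u) (hup : ∃ x ∈ box a, 0 < u x) : Λ ≤ lam := by
  have hφc : ContinuousOn φ (closure (box a)) := hφ.continuous.continuousOn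
  obtain ⟨x, hx, hmax⟩ := (isCompact_closure_box ha).exists_isMaxOn
    ⟨0, subset_closure (zero_mem_box ha)⟩
    (hu.contDiffOn_closure.continuousOn.div hφc fun x hx => (hpos x hx).ne')
  set m := u x / φ x with hm
  have hux : u x = m * φ x := (div_mul_cancel₀ _ (hpos x hx).ne').symm
  have hm0 : 0 < m := by
    obtain ⟨y, hy, hy0⟩ := hup
    exact (div_pos hy0 (hpos y (subset_closure hy))).trans_le (hmax (subset_closure hy))
  have hφx := hpos x hx
  -- Since `m` is the maximum of `u / φ`, `w` is nonpositive on the closed box and vanishes at `x`.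
  set w : EuclideanSpace ℝ (Fin N) → ℝ := u - m • φ with hw
  have hwmax : IsMaxOn w (closure (box a)) x := by
    intro y hy
    have h1 : u y / φ y ≤ m := hmax hy
    rw [div_le_iff₀ (hpos y hy)] at h1
    change u y - m * φ y ≤ u x - m * φ x
    linarith
  have hud : DifferentiableWithinAt ℝ u (closure (box a)) x :=
    hu.contDiffOn_closure.differentiableOn (by simp) x hx
  have hφd : DifferentiableWithinAt ℝ φ (closure (box a)) x :=
    (hφ.differentiable (by simp) x).differentiableWithinAt
  have hwd : DifferentiableWithinAt ℝ w (closure (box a)) x := hud.sub (hφd.const_smul m)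
  have hpd : ∀ j, partialDeriv a w j x = partialDeriv a u j x - m * partialDeriv a φ j x := by
    intro j
    have hs := uniqueDiffOn_closure_box ha x hx
    simp only [partialDeriv]
    rw [hw, fderivWithin_sub hs hud (hφd.const_smul m), fderivWithin_const_smul hs hφd]
    rfl
  -- On a face, maximality gives `∂w/∂n ≥ 0`, whereas the boundary conditions give `β ∂w/∂n + w < 0`
  -- with `w x = 0`.
  have hxbox : x ∈ box a := by
    by_contra hxn
    have hxf : x ∈ frontier (box a) := by
      rw [(isOpen_box a).frontier_eq]
      exact ⟨hx, hxn⟩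
    rw [frontier_box ha, Set.mem_iUnion] at hxf
    obtain ⟨⟨j, s⟩, hxj, -⟩ := hxf
    cases s with
    | false =>
      have h1 := partialDeriv_nonpos_of_isMaxOn ha hx hwd hwmax hxj
      rw [hpd] at h1
      have h2 := (hu.boundary x hx j).2 hxj
      have h3 := mul_pos hm0 ((hbd x hx j).2 hxj)
      nlinarith [mul_nonneg hβ (neg_nonneg.2 h1)]
    | true =>
      have h1 := partialDeriv_nonneg_of_isMaxOn ha hx hwd hwmax hxj
      rw [hpd] at h1
      have h2 := (hu.boundary x hx j).1 hxj
      have h3 := mul_pos hm0 ((hbd x hx j).1 hxj)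
      nlinarith [mul_nonneg hβ h1]
  have hnhds := (isOpen_box a).mem_nhds hxbox
  have huc : ContDiffAt ℝ 2 u x := hu.contDiffOn_interior.contDiffAt hnhds
  have hmφ : ContDiffAt ℝ 2 (m • φ) x := (hφ.const_smul m).contDiffAt
  -- At the interior maximum, `Δw = (Λ - lam) * m * φ x`, so its sign decides the claim.
  have hlap : (Δ (u - m • φ)) x ≤ 0 := laplacian_nonpos_of_isLocalMax (huc.sub hmφ)
    (hwmax.isLocalMax (Filter.mem_of_superset hnhds subset_closure))
  rw [huc.laplacian_sub hmφ, InnerProductSpace.laplacian_smul m hφ.contDiffAt, heq, smul_eq_mul] at hlap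
  have h1 := hu.equation x hxbox
  rw [hux] at h1
  have h2 : (Λ - lam) * (m * φ x) ≤ 0 := by linarith
  have h3 := nonpos_of_mul_nonpos_left h2 (mul_pos hm0 hφx)
  linarith

lemma IsRobinEigenfunction.neg {β lam : ℝ} (ha : ∀ j, 0 < a j) {u : EuclideanSpace ℝ (Fin N) → ℝ}
    (hu : IsRobinEigenfunction β a lam u) : IsRobinEigenfunction β a lam (-u) where
  contDiffOn_interior := hu.contDiffOn_interior.neg
  contDiffOn_closure := hu.contDiffOn_closure.neg
  nontrivial := by simpa using hu.nontrivial
  equation x hx := by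
    rw [InnerProductSpace.laplacian_neg, Pi.neg_apply, Pi.neg_apply]
    linarith [hu.equation x hx]
  boundary x hx j := by
    have h : partialDeriv a (-u) j x = -partialDeriv a u j x := by
      simp only [partialDeriv]
      rw [fderivWithin_neg (uniqueDiffOn_closure_box ha x hx)]
      rfl
    obtain ⟨h1, h2⟩ := hu.boundary x hx j
    rw [h, Pi.neg_apply]
    exact ⟨fun hj => by linarith [h1 hj], fun hj => by linarith [h2 hj]⟩

lemma cos_pos_of_mem_closure_box {k : Fin N → ℝ} (ha : ∀ j, 0 < a j) (hk : ∀ j, 0 < k j)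
    (hka : ∀ j, k j * a j < Real.pi / 2) {x : EuclideanSpace ℝ (Fin N)}
    (hx : x ∈ closure (box a)) (j : Fin N) : 0 < Real.cos (k j * x j) := by
  rw [closure_box ha] at hx
  have h1 := mul_le_mul_of_nonneg_left (hx j).1 (hk j).le
  have h2 := mul_le_mul_of_nonneg_left (hx j).2 (hk j).le
  exact Real.cos_pos_of_mem_Ioo ⟨by linarith [hka j], by linarith [hka j]⟩

lemma sum_sq_le_eigenvalue_of_lt {β lam : ℝ} (hβ : 0 ≤ β) (ha : ∀ j, 0 < a j) {k : Fin N → ℝ}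
    (hk : ∀ j, 0 < k j) (hka : ∀ j, Real.arctan (β * k j) + a j * k j < Real.pi / 2)
    {u : EuclideanSpace ℝ (Fin N) → ℝ} (hu : IsRobinEigenfunction β a lam u) :
    ∑ j, k j ^ 2 ≤ lam := by
  have hka' : ∀ j, k j * a j < Real.pi / 2 := fun j => by
    have : 0 ≤ Real.arctan (β * k j) := Real.arctan_nonneg.2 (mul_nonneg hβ (hk j).le)
    linarith [hka j]
  have hcos : ∀ x ∈ closure (box a), ∀ j, 0 < Real.cos (k j * x j) := fun x hx j =>
    cos_pos_of_mem_closure_box ha hk hka' hx j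
  have hbd : ∀ x ∈ closure (box a), ∀ j,
      (x j = a j → 0 < β * partialDeriv a (cosProd k) j x + cosProd k x) ∧
      (x j = -a j → 0 < β * (-partialDeriv a (cosProd k) j x) + cosProd k x) := by
    intro x hx j
    have hprod : 0 < ∏ i ∈ Finset.univ.erase j, Real.cos (k i * x i) :=
      Finset.prod_pos fun i _ => hcos x hx i
    have h := mul_pos (sub_pos.2 (mul_lt_cos_of_lt_frequency hβ (ha j) (hk j) (hka j))) hprod
    rw [partialDeriv_cosProd ha k j hx, cosProd_eq k x j]
    constructor
    · intro hj
      rw [hj]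
      linarith
    · intro hj
      rw [hj, mul_neg (k j), Real.cos_neg, Real.sin_neg]
      linarith
  obtain ⟨x, hx, hne⟩ := hu.nontrivial
  -- The comparison needs a point where the eigenfunction is positive; otherwise `-u` is used.
  rcases lt_or_gt_of_ne hne with h | h
  · exact le_eigenvalue_of_positive_supersolution hβ ha (contDiff_cosProd k)
      (fun x hx => Finset.prod_pos fun j _ => hcos x hx j) (laplacian_cosProd k) hbd (hu.neg ha)
      ⟨x, hx, neg_pos.2 h⟩
  · exact le_eigenvalue_of_positive_supersolution hβ ha (contDiff_cosProd k)
      (fun x hx => Finset.prod_pos fun j _ => hcos x hx j) (laplacian_cosProd k) hbd hu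
      ⟨x, hx, h⟩

/-- At the exact frequencies the boundary inequality is no longer strict, and for `β = 0` the cosine
product vanishes on the boundary. Hence the frequencies are scaled by `s < 1` and `s → 1`. -/
lemma sum_sq_le_eigenvalue {β lam : ℝ} (hβ : 0 ≤ β) (ha : ∀ j, 0 < a j) {k : Fin N → ℝ}
    (hk : ∀ j, 0 < k j) (hka : ∀ j, Real.arctan (β * k j) + a j * k j = Real.pi / 2)
    {u : EuclideanSpace ℝ (Fin N) → ℝ} (hu : IsRobinEigenfunction β a lam u) :
    ∑ j, k j ^ 2 ≤ lam := by
  have hc : ContinuousWithinAt (fun s : ℝ => ∑ j, (s * k j) ^ 2) (Set.Iio 1) 1 :=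
    (continuous_finsetSum _ fun j _ => by fun_prop).continuousWithinAt
  have h1 : Filter.Tendsto (fun s : ℝ => ∑ j, (s * k j) ^ 2) (nhdsWithin 1 (Set.Iio 1))
      (nhds (∑ j, k j ^ 2)) := by simpa [ContinuousWithinAt] using hc
  refine le_of_tendsto h1 ?_
  filter_upwards [Ioo_mem_nhdsLT (zero_lt_one (α := ℝ))] with s hs
  refine sum_sq_le_eigenvalue_of_lt hβ ha (k := fun j => s * k j)
    (fun j => mul_pos hs.1 (hk j)) (fun j => ?_) hu
  exact frequency_lt hβ (ha j) (mul_lt_of_lt_one_left (hk j) hs.2) (hka j)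

lemma isRobinEigenfunction_cosProd {β : ℝ} (ha : ∀ j, 0 < a j) {k : Fin N → ℝ}
    (hka : ∀ j, Real.arctan (β * k j) + a j * k j = Real.pi / 2) :
    IsRobinEigenfunction β a (∑ j, k j ^ 2) (cosProd k) where
  contDiffOn_interior := (contDiff_cosProd k).contDiffOn
  contDiffOn_closure := (contDiff_cosProd k).contDiffOn
  nontrivial := ⟨0, zero_mem_box ha, by simp [cosProd]⟩
  equation x _ := by rw [laplacian_cosProd]; ring
  boundary x hx j := by
    have h := cos_eq_of_frequency (hka j)
    rw [partialDeriv_cosProd ha k j hx, cosProd_eq k x j]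
    constructor
    · intro hj
      rw [hj, h]
      ring
    · intro hj
      rw [hj, mul_neg (k j), Real.cos_neg, Real.sin_neg, h]
      ring

/-- The fundamental Robin eigenvalue of a box is the sum of the squares of the one-dimensional
frequencies. -/
lemma isFundamentalEigenvalue_sum_sq {β : ℝ} (hβ : 0 ≤ β) (ha : ∀ j, 0 < a j) {k : Fin N → ℝ}
    (hk : ∀ j, 0 < k j) (hka : ∀ j, Real.arctan (β * k j) + a j * k j = Real.pi / 2) :
    IsFundamentalEigenvalue β a (∑ j, k j ^ 2) :=
  ⟨⟨_, isRobinEigenfunction_cosProd ha hka⟩, fun _ ⟨_, hu⟩ => sum_sq_le_eigenvalue hβ ha hk hka hu⟩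

/-! ### Comparison with the cube -/

lemma sum_prod_div_eq {n : ℕ} {a : Fin (n + 1) → ℝ} (ha : ∀ j, 0 < a j) {h : ℝ} (hh : 0 < h)
    (hP : perimeter (box a) = perimeter (box fun _ : Fin (n + 1) => h)) :
    ∑ j, ∏ i, a (Fin.succAbove j i) / h = n + 1 := by
  have hpos : ∀ b : Fin (n + 1) → ℝ, (∀ j, 0 < b j) →
      0 ≤ ∑ j, 2 * ∏ i, 2 * b (Fin.succAbove j i) := fun b hb =>
    Finset.sum_nonneg fun j _ => mul_nonneg zero_le_two
      (Finset.prod_nonneg fun i _ => by linarith [hb (Fin.succAbove j i)])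
  rw [perimeter_box ha, perimeter_box fun _ => hh,
    ENNReal.ofReal_eq_ofReal_iff (hpos a ha) (hpos _ fun _ => hh)] at hP
  simp only [Finset.prod_mul_distrib, Finset.prod_const, Finset.card_univ, Fintype.card_fin,
    ← Finset.mul_sum, Finset.sum_const, nsmul_eq_mul] at hP
  have h1 : ∑ j, ∏ i, a (Fin.succAbove j i) = (n + 1) * h ^ n := by
    have h2 : (2 : ℝ) * 2 ^ n ≠ 0 := by positivity
    refine mul_left_cancel₀ h2 ?_
    push_cast at hP
    linarith
  simp only [Finset.prod_div_distrib, Finset.prod_const, Finset.card_univ, Fintype.card_fin,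
    ← Finset.sum_div]
  rw [h1]
  field_simp

lemma exists_cube_perimeter {n : ℕ} (hn : 1 ≤ n) {P : ℝ} (hP : 0 < P) :
    ∃ h : ℝ, 0 < h ∧ perimeter (box fun _ : Fin (n + 1) => h) = ENNReal.ofReal P := by
  have hc : 0 < P / (2 * (n + 1) * 2 ^ n) := by positivity
  -- The cube has perimeter `2 * (n + 1) * 2 ^ n * h ^ n`, solved here for `h`.
  refine ⟨(P / (2 * (n + 1) * 2 ^ n)) ^ ((n : ℝ)⁻¹), Real.rpow_pos_of_pos hc _, ?_⟩
  rw [perimeter_box fun _ => Real.rpow_pos_of_pos hc _]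
  congr 1
  simp only [Finset.prod_const, Finset.card_univ, Fintype.card_fin, Finset.sum_const, nsmul_eq_mul,
    mul_pow, Real.rpow_inv_natCast_pow hc.le (by omega : n ≠ 0)]
  push_cast
  field_simp

lemma sum_sq_comparison {n : ℕ} (hn : 1 ≤ n) {β : ℝ} (hβ : 0 ≤ β) {a k : Fin (n + 1) → ℝ}
    (ha : ∀ j, 0 < a j) (hk : ∀ j, 0 < k j)
    (hka : ∀ j, Real.arctan (β * k j) + a j * k j = Real.pi / 2) {h κ : ℝ} (hh : 0 < h)
    (hκ : 0 < κ) (hκh : Real.arctan (β * κ) + h * κ = Real.pi / 2)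
    (hP : ∑ j, ∏ i, a (Fin.succAbove j i) / h = n + 1) :
    ∑ _j : Fin (n + 1), κ ^ 2 ≤ ∑ j, k j ^ 2 ∧
      (∑ j, k j ^ 2 = ∑ _j : Fin (n + 1), κ ^ 2 → ∀ j, a j = h) := by
  obtain ⟨C, hC, htan⟩ := exists_tangent_line hβ hκ
  obtain ⟨h1, h2⟩ := sum_log_nonpos hn (b := fun j => a j / h) (fun j => div_pos (ha j) hh) hP
  have hlen : ∀ {a κ : ℝ}, 0 < κ → Real.arctan (β * κ) + a * κ = Real.pi / 2 →
      arccot (β * κ) / κ = a := fun {a κ} hκ h => by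
    rw [div_eq_iff hκ.ne', arccot]
    linarith
  have hle : ∀ j, κ ^ 2 - C * Real.log (a j / h) ≤ k j ^ 2 := fun j => by
    have := htan (k j) (hk j)
    rw [hlen hκ hκh, hlen (hk j) (hka j)] at this
    rw [Real.log_div (ha j).ne' hh.ne']
    linarith
  have hsum := Finset.sum_le_sum fun j (_ : j ∈ Finset.univ) => hle j
  rw [Finset.sum_sub_distrib, ← Finset.mul_sum] at hsum
  have h3 := mul_nonneg hC.le (neg_nonneg.2 h1)
  refine ⟨by linarith, fun heq j => ?_⟩
  -- Equal eigenvalues force the logarithmic sum up to zero, so rigidity comes from the geometric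
  -- inequality alone; strict convexity is not needed.
  have h4 : 0 ≤ C * ∑ j, Real.log (a j / h) := by linarith
  have h5 := h2 (le_antisymm h1 (nonneg_of_mul_nonneg_right h4 hC)) j
  exact (div_eq_one_iff_eq hh.ne').1 h5

end RobinBox

theorem mainTheorem12 (N : ℕ) (hN : 2 ≤ N) (β : ℝ) (hβ : 0 ≤ β) (P : ℝ) (hP : 0 < P) :
    ∃ h : ℝ, 0 < h ∧
      RobinBox.perimeter (RobinBox.box (fun _ : Fin N => h)) = ENNReal.ofReal P ∧
      ∃ lamCube : ℝ, RobinBox.IsFundamentalEigenvalue β (fun _ : Fin N => h) lamCube ∧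
        ∀ a : Fin N → ℝ, (∀ j, 0 < a j) →
          RobinBox.perimeter (RobinBox.box a) = ENNReal.ofReal P →
          ∃ lam : ℝ, RobinBox.IsFundamentalEigenvalue β a lam ∧ lamCube ≤ lam ∧
            (lam = lamCube → ∀ j, a j = h) := by
  obtain ⟨n, rfl⟩ : ∃ n, N = n + 1 := ⟨N - 1, by omega⟩
  have hn : 1 ≤ n := by omega
  obtain ⟨h, hh, hper⟩ := RobinBox.exists_cube_perimeter hn hP
  obtain ⟨κ, hκ, hκh⟩ := RobinBox.exists_frequency hβ hh
  refine ⟨h, hh, hper, _, RobinBox.isFundamentalEigenvalue_sum_sq hβ (fun _ => hh)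
    (k := fun _ => κ) (fun _ => hκ) (fun _ => hκh), fun a ha hPa => ?_⟩
  choose k hk hka using fun j => RobinBox.exists_frequency hβ (ha j)
  exact ⟨_, RobinBox.isFundamentalEigenvalue_sum_sq hβ ha hk hka,
    RobinBox.sum_sq_comparison hn hβ ha hk hka hh hκ hκh
      (RobinBox.sum_prod_div_eq ha hh (hPa.trans hper.symm))⟩
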